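/- Let $\mathbb{K}=\mathbb{R}$ or $\mathbb{C}$, let $m\ge 2$ be an integer, and let $\|T\|$ denote the usual norm of a continuous $m$-linear form, i.e. the supremum of $|T(x_1,\dots,x_m)|$ over $x_1,\dots,x_m$ in the closed unit balls; $e_j$ are the canonical unit vectors. (a) Let $p_1,\dots,p_m\in(1,\infty]$ (with $1/\infty=0$) satisfy $$\frac12\le |1/\mathbf p|:=\frac1{p_1}+\cdots+\frac1{p_m}<1 .$$ Then for all positive integers $n$ and all $m$-linear forms $T:\ell_{p_1}^n\times\cdots\times\ell_{p_m}^n\to\mathbb{K}$, $$\Bigl(\sum_{j_1,\dots,j_m=1}^n |T(e_{j_1},\dots,e_{j_m})|^{\frac1{1-|1/\mathbf p|}}\Bigr)^{1-|1/\mathbf p|}\le 2^{(m-1)(1-|1/\mathbf p|)}\,\|T\| .$$ (b) In particular, if $m<p\le 2m$, then for all continuous $m$-linear forms $T:\ell_p\times\cdots\times\ell_p\to\mathbb{K}$ the following series converges and $$\Bigl(\sum_{j_1,\dots,j_m=1}^\infty |T(e_{j_1},\dots,e_{j_m})|^{\frac p{p-m}}\Bigr)^{\frac{p-m}p}\le 2^{\frac{(m-1)(p-m)}p}\,\|T\|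 .$$ Moreover the Hardy–Littlewood constant $B_{m,p}^{\mathbb{K}}$, defined as the infimum of all $C\ge 0$ such that $$\Bigl(\sum_{j_1,\dots,j_m=1}^n |T(e_{j_1},\dots,e_{j_m})|^{\frac p{p-m}}\Bigr)^{\frac{p-m}p}\le C\,\|T\|$$ for all positive integers $n$ and all $m$-linear forms $T:\ell_p^n\times\cdots\times\ell_p^n\to\mathbb{K}$, satisfies $B_{m,p}^{\mathbb{K}}\le 2^{(m-1)(p-m)/p}$. (c) Hence, if $m<p\le m+1$, the inequality for infinite sums in (b) holds with the constant $2^{\frac{m-1}{m+1}}<2$ in place of $2^{(m-1)(p-m)/p}$, and $B_{m,p}^{\mathbb{K}}<2$. -/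

import Mathlib

open scoped ENNReal NNReal

/-- The space `ℓ_p^n` of `n`-tuples of scalars with the `ℓ_p` norm. -/
abbrev FinEll (𝕜 : Type*) (p : ℝ≥0∞) (n : ℕ) : Type _ :=
  PiLp p (fun _ : Fin n => 𝕜)

/-- The sequence space `ℓ_p` of scalar sequences. -/
abbrev Ell (𝕜 : Type*) [RCLike 𝕜] (p : ℝ≥0∞) : Type _ :=
  lp (fun _ : ℕ => 𝕜) p

/-- Every multilinear form on finite-dimensional `ℓ_p` spaces is continuous. -/
theorem finEll_multilinear_continuous {𝕜 : Type*} [RCLike 𝕜] {m n : ℕ} {p : Fin m → ℝ≥0∞}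
    [∀ j, Fact (1 ≤ p j)] (T : MultilinearMap 𝕜 (fun j => FinEll 𝕜 (p j) n) 𝕜) :
    Continuous T := by
  classical
  have h : ∀ x : (∀ j, FinEll 𝕜 (p j) n),
      T x = ∑ k : Fin m → Fin n, (∏ j, x j (k j)) • T (fun j => PiLp.single (p j) (k j) (1 : 𝕜)) := by
    intro x
    have hx : x = fun j => ∑ i : Fin n, (x j i) • PiLp.single (p j) i (1 : 𝕜) := by
      funext j
      ext i
      simp [Pi.single_apply]
    conv_lhs => rw [hx]
    rw [MultilinearMap.map_sum]
    refine Finset.sum_congr rfl fun k _ => ?_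
    exact MultilinearMap.map_smul_univ T (fun j => x j (k j)) _
  have h' : (T : (∀ j, FinEll 𝕜 (p j) n) → 𝕜) = fun x => ∑ k : Fin m → Fin n,
      (∏ j, x j (k j)) • T (fun j => PiLp.single (p j) (k j) (1 : 𝕜)) := funext h
  rw [h']
  fun_prop

/-- The norm of an `m`-linear form on `ℓ_{p_1}^n × ⋯ × ℓ_{p_m}^n`: the least `C ≥ 0` such that
`|T(x_1, …, x_m)| ≤ C ‖x_1‖ ⋯ ‖x_m‖` for all `x_1, …, x_m`. -/
noncomputable def finEllFormNorm {𝕜 : Type*} [RCLike 𝕜] {m n : ℕ} {p : Fin m → ℝ≥0∞}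
    [∀ j, Fact (1 ≤ p j)] (T : MultilinearMap 𝕜 (fun j => FinEll 𝕜 (p j) n) 𝕜) : ℝ :=
  ‖(⟨T, finEll_multilinear_continuous T⟩ :
    ContinuousMultilinearMap 𝕜 (fun j => FinEll 𝕜 (p j) n) 𝕜)‖

/-- The optimal Hardy–Littlewood constant for `m`-linear forms on `ℓ_p`, `m < p ≤ 2m`: the infimum
of the constants `C ≥ 0` with
`(∑_{k_1,…,k_m=1}^n |T(e_{k_1},…,e_{k_m})|^{p/(p-m)})^{(p-m)/p} ≤ C ‖T‖`
for all positive integers `n` and all `m`-linear forms `T` on `ℓ_p^n × ⋯ × ℓ_p^n`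
(with value `∞` if there is no such `C`). -/
noncomputable def hardyLittlewoodConstant (𝕜 : Type*) [RCLike 𝕜] (m : ℕ) (p : ℝ)
    [Fact (1 ≤ ENNReal.ofReal p)] : ℝ≥0∞ :=
  ⨅ (C : ℝ≥0) (_ : ∀ n : ℕ, 1 ≤ n →
      ∀ T : MultilinearMap 𝕜 (fun _ : Fin m => FinEll 𝕜 (ENNReal.ofReal p) n) 𝕜,
      (∑ k : Fin m → Fin n,
        ‖T (fun j => PiLp.single (ENNReal.ofReal p) (k j) (1 : 𝕜))‖ ^ (p / (p - m))) ^ ((p - m) / p)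
        ≤ C * finEllFormNorm T), (C : ℝ≥0∞)

/-! Put s = 1/(1 - |1/𝐩|), so that |1/𝐩| ≥ 1/2 means s ≥ 2. For a Rademacher sum R = ∑ ε_j v_j, a
Poincaré inequality for even functions on the cube gives ∑ |v_j|² = E|R|² ≤ 2 (E|R|)², while
trivially max |v_j| ≤ E|R|. Interpolating, ‖v‖_s ≤ 2^{1/s} E|R| (`khinchine_rpow`). Applied in all
variables but one, this yields the mixed (ℓ_1, ℓ_s) inequality for forms on ℓ_∞ with constant
2^{(m-1)/s} (`mixed_littlewood`).

The passage to ℓ_p (`hardyLittlewood_array`) uses a single test weight. Normalise |a_k|^s to a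
probability μ with marginals M_l, and multiply a by W(k) = ∏ M_l(k_l)^{1/p_l}. As M_l^{1/p_l} lies
in the unit ball of ℓ_{p_l}, the array W·a defines a form on ℓ_∞ of norm at most ‖T‖. The mixed
inequalities for W·a, averaged over the distinguished variable with weights proportional to 1/p_l,
bound ‖a‖_s by weighted AM-GM, with no further loss in the constant. -/

/-! ### Poincaré inequalities on the discrete cube -/

/-- The sign `±1` in `𝕜` encoded by a Boolean. -/
def boolSign (𝕜 : Type*) [RCLike 𝕜] (b : Bool) : 𝕜 := if b then 1 else -1

/-- The point of the discrete cube with the `i`-th coordinate reversed. -/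
def cubeFlip {n : ℕ} (i : Fin n) (ε : Fin n → Bool) : Fin n → Bool :=
  Function.update ε i (!ε i)

/-- The point of the discrete cube with all coordinates reversed. -/
def cubeNeg {n : ℕ} (ε : Fin n → Bool) : Fin n → Bool := fun i => !ε i

/-- The (unnormalised) Dirichlet form on the discrete cube. -/
def cubeEnergy {n : ℕ} (f : (Fin n → Bool) → ℝ) : ℝ :=
  ∑ i, ∑ ε, (f ε - f (cubeFlip i ε)) ^ 2

theorem norm_boolSign (𝕜 : Type*) [RCLike 𝕜] (b : Bool) : ‖boolSign 𝕜 b‖ = 1 := by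
  cases b <;> simp [boolSign]

theorem boolSign_not (𝕜 : Type*) [RCLike 𝕜] (b : Bool) : boolSign 𝕜 (!b) = -boolSign 𝕜 b := by
  cases b <;> simp [boolSign]

theorem cubeFlip_involutive {n : ℕ} (i : Fin n) : Function.Involutive (cubeFlip i) := by
  intro ε; simp [cubeFlip]

theorem cubeNeg_involutive {n : ℕ} : Function.Involutive (cubeNeg (n := n)) := by
  intro ε; ext i; simp [cubeNeg]

theorem sum_comp_cubeFlip {n : ℕ} (i : Fin n) (f : (Fin n → Bool) → ℝ) :
    ∑ ε, f (cubeFlip i ε) = ∑ ε, f ε :=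
  Equiv.sum_comp (cubeFlip_involutive i).toPerm f

theorem sum_comp_cubeNeg {n : ℕ} (f : (Fin n → Bool) → ℝ) :
    ∑ ε, f (cubeNeg ε) = ∑ ε, f ε :=
  Equiv.sum_comp (cubeNeg_involutive (n := n)).toPerm f

theorem sum_fin_succ_pi {α M : Type*} [Fintype α] [AddCommMonoid M] {n : ℕ}
    (f : (Fin (n + 1) → α) → M) :
    ∑ k, f k = ∑ i, ∑ k', f (Fin.cons i k') := by
  rw [← Fintype.sum_prod_type', ← Equiv.sum_comp (Fin.consEquiv (fun _ => α)) f]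
  rfl

theorem cubeFlip_zero_cons {n : ℕ} (b : Bool) (ε : Fin n → Bool) :
    cubeFlip 0 (Fin.cons b ε : Fin (n + 1) → Bool) = Fin.cons (!b) ε := by
  simp [cubeFlip, Fin.update_cons_zero]

theorem cubeFlip_succ_cons {n : ℕ} (i : Fin n) (b : Bool) (ε : Fin n → Bool) :
    cubeFlip i.succ (Fin.cons b ε : Fin (n + 1) → Bool) = Fin.cons b (cubeFlip i ε) := by
  simp [cubeFlip, Fin.cons_update]

theorem cubeNeg_cons {n : ℕ} (b : Bool) (ε : Fin n → Bool) :
    cubeNeg (Fin.cons b ε : Fin (n + 1) → Bool) = Fin.cons (!b) (cubeNeg ε) := by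
  ext j
  refine Fin.cases ?_ (fun j => ?_) j <;> simp [cubeNeg]

/-- Edges of the cube lie in one of two opposite facets or join them; a joining edge is counted from
both ends, whence the factor 2. -/
theorem cubeEnergy_succ {n : ℕ} (f : (Fin (n + 1) → Bool) → ℝ) :
    cubeEnergy f = cubeEnergy (fun ε => f (Fin.cons true ε))
      + cubeEnergy (fun ε => f (Fin.cons false ε))
      + 2 * ∑ ε, (f (Fin.cons true ε) - f (Fin.cons false ε)) ^ 2 := by
  unfold cubeEnergy
  rw [Fin.sum_univ_succ]
  simp only [sum_fin_succ_pi, Fintype.sum_bool, cubeFlip_zero_cons, cubeFlip_succ_cons,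
    Finset.sum_add_distrib, Bool.not_true, Bool.not_false]
  have : ∀ ε : Fin n → Bool, (f (Fin.cons false ε) - f (Fin.cons true ε)) ^ 2
      = (f (Fin.cons true ε) - f (Fin.cons false ε)) ^ 2 := fun ε => by ring
  simp only [this]
  ring

/-- Poincaré inequality on the discrete cube. -/
theorem cube_poincare {n : ℕ} (f : (Fin n → Bool) → ℝ) :
    4 * (2 ^ n * ∑ ε, f ε ^ 2 - (∑ ε, f ε) ^ 2) ≤ 2 ^ n * cubeEnergy f := by
  induction n with
  | zero => simp [cubeEnergy]
  | succ n ih =>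
    have h1 := ih (fun ε => f (Fin.cons true ε))
    have h0 := ih (fun ε => f (Fin.cons false ε))
    -- Beyond the facet variances, the variance contains the squared difference of the facet sums;
    -- by Cauchy–Schwarz the joining edges control it.
    have hc : (∑ ε : Fin n → Bool, (f (Fin.cons true ε) - f (Fin.cons false ε))) ^ 2
        ≤ 2 ^ n * ∑ ε : Fin n → Bool, (f (Fin.cons true ε) - f (Fin.cons false ε)) ^ 2 := by
      simpa using sq_sum_le_card_mul_sum_sq (s := (Finset.univ : Finset (Fin n → Bool)))
        (f := fun ε => f (Fin.cons true ε) - f (Fin.cons false ε))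
    rw [Finset.sum_sub_distrib] at hc
    rw [cubeEnergy_succ]
    simp only [sum_fin_succ_pi, Fintype.sum_bool, pow_succ (2 : ℝ) n]
    nlinarith

/-- The energy is a quadratic form. With g the reflection of f, this separates the even and odd
parts. -/
theorem cubeEnergy_parallelogram {n : ℕ} (f g : (Fin n → Bool) → ℝ) :
    cubeEnergy f + cubeEnergy g = 2 * cubeEnergy (fun ε => (f ε + g ε) / 2)
      + 2 * cubeEnergy (fun ε => (f ε - g ε) / 2) := by
  unfold cubeEnergy
  simp only [Finset.mul_sum, ← Finset.sum_add_distrib]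
  refine Finset.sum_congr rfl fun i _ => Finset.sum_congr rfl fun ε _ => ?_
  ring

/-- The Poincaré inequality on the discrete cube with the doubled spectral gap, for even
functions. -/
theorem cube_poincare_even {n : ℕ} (f : (Fin n → Bool) → ℝ) (hf : ∀ ε, f (cubeNeg ε) = f ε) :
    8 * (2 ^ n * ∑ ε, f ε ^ 2 - (∑ ε, f ε) ^ 2) ≤ 2 ^ n * cubeEnergy f := by
  induction n with
  | zero => simp [cubeEnergy]
  | succ n ih =>
    set g : (Fin n → Bool) → ℝ := fun ε => f (Fin.cons true ε) with hg
    have hg' : ∀ ε, f (Fin.cons false ε) = g (cubeNeg ε) := fun ε => by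
      rw [hg, ← hf, cubeNeg_cons]; rfl
    -- An even f is determined by its restriction g to one facet. The even part of g has the doubled
    -- gap by induction; the odd part has only the ordinary gap, and the edges joining the facets
    -- supply the missing half.
    have he := ih (fun ε => (g ε + g (cubeNeg ε)) / 2)
      (fun ε => by simp only [cubeNeg_involutive ε]; ring)
    have ho := cube_poincare (fun ε => (g ε - g (cubeNeg ε)) / 2)
    have hpar := cubeEnergy_parallelogram g (fun ε => g (cubeNeg ε))
    have hso : ∑ ε, (g ε - g (cubeNeg ε)) / 2 = 0 := by
      rw [← Finset.sum_div, Finset.sum_sub_distrib, sum_comp_cubeNeg]; simp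
    have hse : ∑ ε, (g ε + g (cubeNeg ε)) / 2 = ∑ ε, g ε := by
      rw [← Finset.sum_div, Finset.sum_add_distrib, sum_comp_cubeNeg]; ring
    have hsq : ∑ ε, g ε ^ 2 = ∑ ε, ((g ε + g (cubeNeg ε)) / 2) ^ 2
        + ∑ ε, ((g ε - g (cubeNeg ε)) / 2) ^ 2 := by
      have h1 := sum_comp_cubeNeg (fun ε => g ε ^ 2)
      have h2 : ∑ ε, g ε ^ 2 + ∑ ε, g (cubeNeg ε) ^ 2
          = 2 * (∑ ε, ((g ε + g (cubeNeg ε)) / 2) ^ 2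
            + ∑ ε, ((g ε - g (cubeNeg ε)) / 2) ^ 2) := by
        simp only [Finset.mul_sum, ← Finset.sum_add_distrib]
        exact Finset.sum_congr rfl fun ε _ => by ring
      linarith
    have hdiff : ∑ ε, (g ε - g (cubeNeg ε)) ^ 2
        = 4 * ∑ ε, ((g ε - g (cubeNeg ε)) / 2) ^ 2 := by
      rw [Finset.mul_sum]
      exact Finset.sum_congr rfl fun ε _ => by ring
    rw [cubeEnergy_succ]
    simp only [sum_fin_succ_pi, Fintype.sum_bool, pow_succ (2 : ℝ) n, hg']
    rw [sum_comp_cubeNeg g, sum_comp_cubeNeg (fun ε => g ε ^ 2), hdiff, hpar, hsq]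
    rw [hso] at ho
    rw [hse] at he
    nlinarith

/-! ### Rademacher sums and Khinchine's inequality -/

/-- The Rademacher sum `∑ ε_j v_j`. -/
def rademacherSum {𝕜 : Type*} [RCLike 𝕜] {n : ℕ} (v : Fin n → 𝕜) (ε : Fin n → Bool) : 𝕜 :=
  ∑ j, boolSign 𝕜 (ε j) * v j

theorem rademacherSum_cubeNeg {𝕜 : Type*} [RCLike 𝕜] {n : ℕ} (v : Fin n → 𝕜)
    (ε : Fin n → Bool) : rademacherSum v (cubeNeg ε) = -rademacherSum v ε := by
  simp [rademacherSum, cubeNeg, boolSign_not]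

theorem rademacherSum_cubeFlip {𝕜 : Type*} [RCLike 𝕜] {n : ℕ} (v : Fin n → 𝕜) (i : Fin n)
    (ε : Fin n → Bool) :
    rademacherSum v (cubeFlip i ε) = rademacherSum v ε - 2 * (boolSign 𝕜 (ε i) * v i) := by
  unfold rademacherSum
  rw [← Finset.add_sum_erase _ _ (Finset.mem_univ i),
    ← Finset.add_sum_erase _ (fun j => boolSign 𝕜 (ε j) * v j) (Finset.mem_univ i)]
  have : ∑ j ∈ Finset.univ.erase i, boolSign 𝕜 (cubeFlip i ε j) * v j
      = ∑ j ∈ Finset.univ.erase i, boolSign 𝕜 (ε j) * v j :=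
    Finset.sum_congr rfl fun j hj => by simp [cubeFlip, Finset.ne_of_mem_erase hj]
  rw [this]
  simp only [cubeFlip, Function.update_self, boolSign_not]
  ring

/-- The offset w absorbs one term at each induction step, by the parallelogram law; w = 0 gives
E|R|² = ∑ |v_j|². -/
theorem sum_norm_sq_add_rademacherSum {𝕜 : Type*} [RCLike 𝕜] {n : ℕ} (v : Fin n → 𝕜) (w : 𝕜) :
    ∑ ε, ‖w + rademacherSum v ε‖ ^ 2 = 2 ^ n * (‖w‖ ^ 2 + ∑ j, ‖v j‖ ^ 2) := by
  induction n generalizing w with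
  | zero => simp [rademacherSum]
  | succ n ih =>
    have hc : ∀ b ε, rademacherSum v (Fin.cons b ε : Fin (n + 1) → Bool)
        = boolSign 𝕜 b * v 0 + rademacherSum (fun j => v j.succ) ε := fun b ε => by
      simp [rademacherSum, Fin.sum_univ_succ]
    simp only [sum_fin_succ_pi, Fintype.sum_bool, hc, ← add_assoc, ih]
    have := parallelogram_law_with_norm 𝕜 w (v 0)
    simp only [boolSign, if_true, Bool.false_eq_true, if_false, one_mul, neg_mul,
      ← sub_eq_add_neg, Fin.sum_univ_succ]
    rw [pow_succ]
    linear_combination (2 : ℝ) ^ n * this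

/-- The comparison of the first two moments of a Rademacher sum with the optimal constant
(Latała–Oleszkiewicz). -/
theorem rademacherSum_second_moment_le {𝕜 : Type*} [RCLike 𝕜] {n : ℕ} (v : Fin n → 𝕜) :
    2 ^ n * ∑ ε, ‖rademacherSum v ε‖ ^ 2 ≤ 2 * (∑ ε, ‖rademacherSum v ε‖) ^ 2 := by
  set f : (Fin n → Bool) → ℝ := fun ε => ‖rademacherSum v ε‖ with hf
  have heven := cube_poincare_even f (fun ε => by simp [hf, rademacherSum_cubeNeg])
  -- Reversing coordinate i subtracts 2 ε_i v_i, so the n reversed sums add up to (n - 2) R(ε); then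
  -- the triangle inequality.
  have hflip : ∀ ε, ((n : ℝ) - 2) * f ε ≤ ∑ i, f (cubeFlip i ε) := by
    intro ε
    have h1 : ∑ i, rademacherSum v (cubeFlip i ε) = ((n : 𝕜) - 2) * rademacherSum v ε := by
      simp only [rademacherSum_cubeFlip, Finset.sum_sub_distrib, ← Finset.mul_sum]
      simp [rademacherSum]; ring
    have h2 : ‖((n : 𝕜) - 2) * rademacherSum v ε‖ ≤ ∑ i, f (cubeFlip i ε) := by
      rw [← h1]; exact norm_sum_le _ _
    refine le_trans ?_ h2
    rw [norm_mul]
    refine mul_le_mul_of_nonneg_right ?_ (norm_nonneg _)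
    have : ((n : 𝕜) - 2) = (((n : ℝ) - 2 : ℝ) : 𝕜) := by push_cast; rfl
    rw [this, RCLike.norm_ofReal]
    exact le_abs_self _
  -- Expanding the squares leaves the factor 2n - 2(n - 2) = 4. Against the 8 of `heven`, this gives
  -- the constant 2.
  have henergy : cubeEnergy f ≤ 4 * ∑ ε, f ε ^ 2 := by
    have h1 : cubeEnergy f = ∑ i : Fin n, (2 * ∑ ε, f ε ^ 2 - 2 * ∑ ε, f ε * f (cubeFlip i ε)) := by
      unfold cubeEnergy
      refine Finset.sum_congr rfl fun i _ => ?_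
      have h := sum_comp_cubeFlip i (fun ε => f ε ^ 2)
      have h' : ∑ ε, (f ε - f (cubeFlip i ε)) ^ 2 = ∑ ε, f ε ^ 2 + ∑ ε, f (cubeFlip i ε) ^ 2
          - 2 * ∑ ε, f ε * f (cubeFlip i ε) := by
        rw [Finset.mul_sum, ← Finset.sum_add_distrib, ← Finset.sum_sub_distrib]
        exact Finset.sum_congr rfl fun ε _ => by ring
      rw [h', h]; ring
    have h2 : ((n : ℝ) - 2) * ∑ ε, f ε ^ 2 ≤ ∑ i : Fin n, ∑ ε, f ε * f (cubeFlip i ε) := by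
      rw [Finset.sum_comm, Finset.mul_sum]
      refine Finset.sum_le_sum fun ε _ => ?_
      rw [← Finset.mul_sum]
      nlinarith [mul_le_mul_of_nonneg_left (hflip ε) (norm_nonneg (rademacherSum v ε))]
    rw [h1, Finset.sum_sub_distrib, ← Finset.mul_sum, ← Finset.mul_sum]
    simp only [Finset.sum_const, Finset.card_univ, Fintype.card_fin, nsmul_eq_mul]
    linarith
  have := mul_le_mul_of_nonneg_left henergy (by positivity : (0 : ℝ) ≤ 2 ^ n)
  linarith

/-- Pair each ε with its reversal at j: the two sums differ by ±2 v_j. -/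
theorem two_pow_mul_norm_le_sum_rademacherSum {𝕜 : Type*} [RCLike 𝕜] {n : ℕ} (v : Fin n → 𝕜)
    (j : Fin n) : 2 ^ n * ‖v j‖ ≤ ∑ ε, ‖rademacherSum v ε‖ := by
  have h : ∀ ε, 2 * ‖v j‖ ≤ ‖rademacherSum v ε‖ + ‖rademacherSum v (cubeFlip j ε)‖ := fun ε => by
    refine le_trans (le_of_eq ?_) (norm_sub_le _ _)
    rw [rademacherSum_cubeFlip, sub_sub_cancel, norm_mul, norm_mul, norm_boolSign]
    simp
  have h2 := Finset.sum_le_sum fun ε (_ : ε ∈ Finset.univ) => h ε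
  rw [Finset.sum_add_distrib, sum_comp_cubeFlip j (fun ε => ‖rademacherSum v ε‖)] at h2
  simp at h2
  linarith

/-- Khinchine's inequality for the `ℓ_s` norm, `2 ≤ s`. -/
theorem khinchine_rpow {𝕜 : Type*} [RCLike 𝕜] {n : ℕ} {s : ℝ} (hs : 2 ≤ s) (v : Fin n → 𝕜) :
    (∑ j, ‖v j‖ ^ s) ^ (1 / s) ≤ 2 ^ (1 / s) * ((∑ ε, ‖rademacherSum v ε‖) / 2 ^ n) := by
  set E : ℝ := (∑ ε, ‖rademacherSum v ε‖) / 2 ^ n with hE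
  have hE0 : 0 ≤ E := by positivity
  have hpow : (0 : ℝ) < 2 ^ n := by positivity
  have hmax : ∀ j, ‖v j‖ ≤ E := fun j => by
    rw [hE, le_div_iff₀ hpow, mul_comm]
    exact two_pow_mul_norm_le_sum_rademacherSum v j
  have hsq : ∑ j, ‖v j‖ ^ 2 ≤ 2 * E ^ 2 := by
    have h1 := rademacherSum_second_moment_le v
    have h2 := sum_norm_sq_add_rademacherSum v 0
    simp only [zero_add, norm_zero, ne_eq, OfNat.ofNat_ne_zero, not_false_eq_true, zero_pow] at h2
    rw [h2] at h1
    rw [hE, div_pow, ← mul_div_assoc, le_div_iff₀ (by positivity)]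
    nlinarith
  have hs0 : 0 < s := by linarith
  -- Interpolation between `hsq` and `hmax`: |v_j|^s ≤ |v_j|² E^{s-2}.
  have key : ∑ j, ‖v j‖ ^ s ≤ 2 * E ^ s := by
    have hsplit : ∀ x : ℝ, 0 ≤ x → x ^ s = x ^ 2 * x ^ (s - 2) := fun x hx => by
      rw [← Real.rpow_two, ← Real.rpow_add_of_nonneg hx (by norm_num) (by linarith)]
      congr 1; ring
    calc ∑ j, ‖v j‖ ^ s ≤ ∑ j, ‖v j‖ ^ 2 * E ^ (s - 2) := by
          refine Finset.sum_le_sum fun j _ => ?_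
          rw [hsplit _ (norm_nonneg _)]
          have := Real.rpow_le_rpow (norm_nonneg _) (hmax j) (by linarith : 0 ≤ s - 2)
          gcongr
      _ ≤ 2 * E ^ 2 * E ^ (s - 2) := by
          rw [← Finset.sum_mul]; gcongr
      _ = 2 * E ^ s := by rw [hsplit E hE0]; ring
  calc (∑ j, ‖v j‖ ^ s) ^ (1 / s) ≤ (2 * E ^ s) ^ (1 / s) := by gcongr
    _ = 2 ^ (1 / s) * E := by
      rw [Real.mul_rpow (by norm_num) (by positivity), ← Real.rpow_mul hE0,
        mul_one_div_cancel hs0.ne', Real.rpow_one]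

/-! ### Multiple Khinchine and mixed Littlewood inequalities -/

/-- Minkowski's inequality for finite sums of nonnegative functions. -/
theorem rpow_sum_sum_rpow_le {ι Ω : Type*} [Fintype ι] (t : Finset Ω) {s : ℝ} (hs : 1 ≤ s)
    (g : Ω → ι → ℝ) (hg : ∀ ω i, 0 ≤ g ω i) :
    (∑ i, (∑ ω ∈ t, g ω i) ^ s) ^ (1 / s) ≤ ∑ ω ∈ t, (∑ i, g ω i ^ s) ^ (1 / s) := by
  classical
  have hs0 : s ≠ 0 := by linarith
  induction t using Finset.induction_on with
  | empty => simp [Real.zero_rpow hs0, Real.zero_rpow (inv_ne_zero hs0)]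
  | insert ω t hω ih =>
    simp only [Finset.sum_insert hω]
    refine (Real.Lp_add_le_of_nonneg _ hs (fun i _ => hg ω i)
      (fun i _ => Finset.sum_nonneg fun ω _ => hg ω i)).trans ?_
    gcongr

/-- The multiple Rademacher sum `∑ ε_{1,k_1} ⋯ ε_{d,k_d} a_k`. -/
def multiRademacherSum {𝕜 : Type*} [RCLike 𝕜] {d n : ℕ} (a : (Fin d → Fin n) → 𝕜)
    (ε : Fin d → Fin n → Bool) : 𝕜 :=
  ∑ k, (∏ l, boolSign 𝕜 (ε l (k l))) * a k

theorem multiRademacherSum_cons {𝕜 : Type*} [RCLike 𝕜] {d n : ℕ}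
    (a : (Fin (d + 1) → Fin n) → 𝕜) (δ : Fin n → Bool) (ε : Fin d → Fin n → Bool) :
    multiRademacherSum a (Fin.cons δ ε : Fin (d + 1) → Fin n → Bool)
      = rademacherSum (fun i => multiRademacherSum (fun k => a (Fin.cons i k)) ε) δ := by
  simp only [multiRademacherSum, rademacherSum, sum_fin_succ_pi, Fin.prod_univ_succ,
    Fin.cons_zero, Fin.cons_succ, Finset.mul_sum, mul_assoc]

/-- Khinchine's inequality for multiple Rademacher sums and the `ℓ_s` norm, `2 ≤ s`. -/
theorem multi_khinchine_rpow {𝕜 : Type*} [RCLike 𝕜] {d n : ℕ} {s : ℝ} (hs : 2 ≤ s)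
    (a : (Fin d → Fin n) → 𝕜) :
    (∑ k, ‖a k‖ ^ s) ^ (1 / s)
      ≤ (2 ^ (1 / s)) ^ d * ((∑ ε, ‖multiRademacherSum a ε‖) / (2 ^ n) ^ d) := by
  have hs0 : s ≠ 0 := by linarith
  induction d with
  | zero =>
    simp [multiRademacherSum, ← Real.rpow_mul (norm_nonneg _), mul_inv_cancel₀ hs0]
  | succ d ih =>
    set c : ℝ := 2 ^ (1 / s) with hc
    have hc0 : 0 < c := by positivity
    set A : Fin n → (Fin d → Fin n → Bool) → 𝕜 :=
      fun i ε => multiRademacherSum (fun k => a (Fin.cons i k)) ε with hA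
    set κ : ℝ := c ^ d / (2 ^ n) ^ d with hκ
    have hκ0 : 0 ≤ κ := by positivity
    have h1 : ∀ i, ∑ k : Fin d → Fin n, ‖a (Fin.cons i k)‖ ^ s ≤ (κ * ∑ ε, ‖A i ε‖) ^ s := by
      intro i
      have h := ih (fun k => a (Fin.cons i k))
      have h' := Real.rpow_le_rpow (by positivity) h (by linarith : (0 : ℝ) ≤ s)
      rw [← Real.rpow_mul (by positivity), one_div_mul_cancel hs0, Real.rpow_one] at h'
      refine h'.trans_eq ?_
      congr 1
      rw [hκ]; ring
    calc (∑ k, ‖a k‖ ^ s) ^ (1 / s)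
        ≤ (∑ i, (κ * ∑ ε, ‖A i ε‖) ^ s) ^ (1 / s) := by
          rw [sum_fin_succ_pi]
          gcongr with i
          exact h1 i
      _ = κ * (∑ i, (∑ ε, ‖A i ε‖) ^ s) ^ (1 / s) := by
          have : ∀ i, (κ * ∑ ε, ‖A i ε‖) ^ s = κ ^ s * (∑ ε, ‖A i ε‖) ^ s := fun i =>
            Real.mul_rpow hκ0 (by positivity)
          simp only [this, ← Finset.mul_sum]
          rw [Real.mul_rpow (by positivity) (by positivity), ← Real.rpow_mul hκ0,
            mul_one_div_cancel hs0, Real.rpow_one]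
      -- Minkowski takes the average over ε out of the ℓ_s norm in i, so Khinchine applies in the
      -- remaining variable for each fixed ε.
      _ ≤ κ * ∑ ε, (∑ i, ‖A i ε‖ ^ s) ^ (1 / s) := by
          gcongr
          exact rpow_sum_sum_rpow_le _ (by linarith) (fun ε i => ‖A i ε‖)
            (fun _ _ => norm_nonneg _)
      _ ≤ κ * ∑ ε, c * ((∑ δ, ‖rademacherSum (fun i => A i ε) δ‖) / 2 ^ n) := by
          gcongr with ε
          exact khinchine_rpow hs _
      _ = _ := by
          rw [sum_fin_succ_pi, Finset.sum_comm, ← Finset.mul_sum, ← Finset.sum_div]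
          simp only [multiRademacherSum_cons, hκ, hA]
          rw [pow_succ, pow_succ]
          field_simp

theorem sum_insertNth {α M : Type*} [Fintype α] [AddCommMonoid M] {d : ℕ} (l : Fin (d + 1))
    (f : (Fin (d + 1) → α) → M) :
    ∑ k, f k = ∑ i, ∑ k', f (l.insertNth i k') := by
  rw [← Fintype.sum_prod_type', ← Equiv.sum_comp (Fin.insertNthEquiv (fun _ => α) l) f]
  rfl

/-- The mixed `(ℓ_1, ℓ_s)` Littlewood inequality for multilinear forms on `ℓ_∞^n`. -/
theorem mixed_littlewood {𝕜 : Type*} [RCLike 𝕜] {d n : ℕ} {s : ℝ} (hs : 2 ≤ s)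
    (a : (Fin (d + 1) → Fin n) → 𝕜) (K : ℝ)
    (h : ∀ u : Fin (d + 1) → Fin n → 𝕜, (∀ l i, ‖u l i‖ ≤ 1) →
      ‖∑ k, (∏ l, u l (k l)) * a k‖ ≤ K) (l₀ : Fin (d + 1)) :
    ∑ i, (∑ k', ‖a (l₀.insertNth i k')‖ ^ s) ^ (1 / s) ≤ (2 ^ (1 / s)) ^ d * K := by
  set A : Fin n → (Fin d → Fin n → Bool) → 𝕜 :=
    fun i ε => multiRademacherSum (fun k => a (l₀.insertNth i k)) ε with hA
  have hbound : ∀ ε, ∑ i, ‖A i ε‖ ≤ K := by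
    intro ε
    -- Phases in the variable l₀ and signs in the others turn ∑ |A_i| into a value of the form. Only
    -- the d sign variables cost a factor 2^{1/s}.
    choose w hw1 hw2 using fun i => RCLike.exists_norm_eq_mul_self (A i ε)
    have := h (l₀.insertNth w fun l i => boolSign 𝕜 (ε l i)) (by
      intro l i
      refine Fin.succAboveCases l₀ ?_ (fun l => ?_) l
      · simp [hw1]
      · simp [norm_boolSign])
    have hsum : ∑ k, (∏ l, (l₀.insertNth w fun l i => boolSign 𝕜 (ε l i) :
        Fin (d + 1) → Fin n → 𝕜) l (k l)) * a k = ((∑ i, ‖A i ε‖ : ℝ) : 𝕜) := by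
      rw [sum_insertNth l₀]
      push_cast
      refine Finset.sum_congr rfl fun i _ => ?_
      refine Eq.trans ?_ (hw2 i).symm
      simp only [Fin.prod_univ_succAbove _ l₀, Fin.insertNth_apply_same,
        Fin.insertNth_apply_succAbove, hA, multiRademacherSum, Finset.mul_sum, mul_assoc]
    rw [hsum, RCLike.norm_ofReal] at this
    exact (le_abs_self _).trans this
  calc ∑ i, (∑ k', ‖a (l₀.insertNth i k')‖ ^ s) ^ (1 / s)
      ≤ ∑ i, (2 ^ (1 / s)) ^ d * ((∑ ε, ‖A i ε‖) / (2 ^ n) ^ d) :=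
        Finset.sum_le_sum fun i _ => multi_khinchine_rpow hs _
    _ = (2 ^ (1 / s)) ^ d * ((∑ ε, ∑ i, ‖A i ε‖) / (2 ^ n) ^ d) := by
        rw [← Finset.mul_sum, ← Finset.sum_div, Finset.sum_comm]
    _ ≤ (2 ^ (1 / s)) ^ d * ((∑ _ε : Fin d → Fin n → Bool, K) / (2 ^ n) ^ d) := by
        gcongr with ε
        exact hbound ε
    _ = (2 ^ (1 / s)) ^ d * K := by
        simp

/-! ### From ℓ_∞ to ℓ_p by a change of density -/

/-- A form of the power mean inequality in which the weights are not normalised. -/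
theorem sum_mul_rpow_mul_le {ι : Type*} [Fintype ι] {s : ℝ} (hs : 1 ≤ s) (w z : ι → ℝ)
    (hw : ∀ i, 0 ≤ w i) (hz : ∀ i, 0 ≤ z i) :
    ∑ i, w i * ((∑ j, w j) ^ (1 / s - 1) * z i) ≤ (∑ i, w i * z i ^ s) ^ (1 / s) := by
  set M := ∑ j, w j with hM
  have hM0 : 0 ≤ M := Finset.sum_nonneg fun i _ => hw i
  -- If the total mass vanishes, all weights do, so the degenerate negative power of 0 plays no
  -- role.
  rcases hM0.eq_or_lt with h | h
  · have hz0 : ∀ i, w i = 0 := fun i =>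
      (Finset.sum_eq_zero_iff_of_nonneg fun i _ => hw i).1 h.symm i (Finset.mem_univ i)
    simp only [hz0, zero_mul, Finset.sum_const_zero]
    positivity
  · have hmean := Real.arith_mean_le_rpow_mean Finset.univ (fun i => w i / M) z
      (fun i _ => div_nonneg (hw i) hM0) (by rw [← Finset.sum_div, div_self h.ne'])
      (fun i _ => hz i) hs
    have hl : ∑ i, w i * (M ^ (1 / s - 1) * z i) = M ^ (1 / s) * ∑ i, w i / M * z i := by
      rw [Finset.mul_sum]
      refine Finset.sum_congr rfl fun i _ => ?_
      rw [Real.rpow_sub_one h.ne']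
      ring
    have hr : (∑ i, w i * z i ^ s) ^ (1 / s)
        = M ^ (1 / s) * (∑ i, w i / M * z i ^ s) ^ (1 / s) := by
      rw [← Real.mul_rpow hM0 (Finset.sum_nonneg fun i _ =>
        mul_nonneg (div_nonneg (hw i) hM0) (Real.rpow_nonneg (hz i) _)), Finset.mul_sum]
      congr 1
      refine Finset.sum_congr rfl fun i _ => ?_
      field_simp
    rw [hl, hr]
    gcongr

/-- If `∑ θ_l = r`, the average of the quantities `x_l^{-r} ∏ x_j^{θ_j}` with weights `θ_l / r` is
at least `1`. -/
theorem one_le_sum_weighted {ι : Type*} [Fintype ι] {r : ℝ} (hr : 0 < r) (θ x : ι → ℝ)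
    (hθ : ∀ l, 0 ≤ θ l) (hsum : ∑ l, θ l = r) (hx : ∀ l, 0 < x l) :
    1 ≤ ∑ l, θ l / r * (x l ^ (-r) * ∏ j, x j ^ θ j) := by
  have hW : 0 < ∏ j, x j ^ θ j := Finset.prod_pos fun j _ => Real.rpow_pos_of_pos (hx j) _
  have hamgm := Real.geom_mean_le_arith_mean_weighted Finset.univ (fun l => θ l / r)
    (fun l => x l ^ (-r) * ∏ j, x j ^ θ j) (fun l _ => div_nonneg (hθ l) hr.le)
    (by rw [← Finset.sum_div, hsum, div_self hr.ne'])
    (fun l _ => mul_nonneg (Real.rpow_nonneg (hx l).le _) hW.le)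
  -- The weighted geometric mean is exactly ∏ x_l^{-θ_l} · ∏ x_j^{θ_j} = 1.
  refine le_trans (le_of_eq ?_) hamgm
  have h1 : ∀ l, (x l ^ (-r) * ∏ j, x j ^ θ j) ^ (θ l / r)
      = (x l ^ θ l)⁻¹ * (∏ j, x j ^ θ j) ^ (θ l / r) := fun l => by
    rw [Real.mul_rpow (Real.rpow_nonneg (hx l).le _) hW.le, ← Real.rpow_mul (hx l).le,
      ← Real.rpow_neg (hx l).le]
    congr 2
    field_simp
  simp only [h1, Finset.prod_mul_distrib, Finset.prod_inv_distrib]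
  rw [← Real.rpow_sum_of_pos hW, ← Finset.sum_div, hsum, div_self hr.ne', Real.rpow_one,
    inv_mul_cancel₀ hW.ne']

/-- Hardy–Littlewood inequality for coefficient arrays: the tuples `(M_l i ^ θ_l u_l i)_i` with
`∑ M_l ≤ 1` and `|u_l| ≤ 1` range over the unit ball of `ℓ_{1/θ_l}`. -/
theorem hardyLittlewood_array {𝕜 : Type*} [RCLike 𝕜] {d n : ℕ} {s : ℝ} (hs : 2 ≤ s)
    (θ : Fin (d + 1) → ℝ) (hθ : ∀ l, 0 ≤ θ l) (hsum : ∑ l, θ l = 1 - 1 / s)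
    (a : (Fin (d + 1) → Fin n) → 𝕜) (K : ℝ)
    (h : ∀ (M : Fin (d + 1) → Fin n → ℝ) (u : Fin (d + 1) → Fin n → 𝕜),
      (∀ l i, 0 ≤ M l i) → (∀ l, ∑ i, M l i ≤ 1) → (∀ l i, ‖u l i‖ ≤ 1) →
      ‖∑ k, (∏ l, (((M l (k l) ^ θ l : ℝ) : 𝕜) * u l (k l))) * a k‖ ≤ K) :
    (∑ k, ‖a k‖ ^ s) ^ (1 / s) ≤ (2 ^ (1 / s)) ^ d * K := by
  have hs0 : 0 < s := by linarith
  have hK : 0 ≤ K := (norm_nonneg _).trans (h 0 0 (by simp) (by simp) (by simp))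
  set C : ℝ := (2 ^ (1 / s)) ^ d * K with hC
  set N := ∑ k, ‖a k‖ ^ s with hN
  have hN0 : 0 ≤ N := by positivity
  rcases hN0.eq_or_lt with hz | hpos
  · rw [← hz, Real.zero_rpow (by positivity)]
    positivity
  set μ : (Fin (d + 1) → Fin n) → ℝ := fun k => ‖a k‖ ^ s / N with hμ
  have hμ0 : ∀ k, 0 ≤ μ k := fun k => by positivity
  have hμ1 : ∑ k, μ k = 1 := by rw [hμ, ← Finset.sum_div, div_self hpos.ne']
  set M : Fin (d + 1) → Fin n → ℝ := fun l i => ∑ k', μ (l.insertNth i k') with hM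
  have hM0 : ∀ l i, 0 ≤ M l i := fun l i => Finset.sum_nonneg fun _ _ => hμ0 _
  have hM1 : ∀ l, ∑ i, M l i = 1 := fun l => by rw [hM, ← sum_insertNth l, hμ1]
  have hμM : ∀ l k, μ k ≤ M l (k l) := fun l k => by
    have := Finset.single_le_sum (f := fun k' => μ (l.insertNth (k l) k'))
      (fun _ _ => hμ0 _) (Finset.mem_univ (l.removeNth k))
    simpa using this
  set W : (Fin (d + 1) → Fin n) → ℝ := fun k => ∏ l, M l (k l) ^ θ l with hW
  have hW0 : ∀ k, 0 ≤ W k := fun k =>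
    Finset.prod_nonneg fun l _ => Real.rpow_nonneg (hM0 _ _) _
  -- The mixed inequality for W·a, where |a_k|^s = N μ_k; the power mean inequality on each slice of
  -- mass M_{l₀}(i) makes the left side linear in W.
  have hmixed : ∀ l₀, N ^ (1 / s) * ∑ k, μ k * (M l₀ (k l₀) ^ (1 / s - 1) * W k) ≤ C := by
    intro l₀
    have h1 := mixed_littlewood hs (fun k => (W k : 𝕜) * a k) K (fun u hu => by
      have := h M u hM0 (fun l => (hM1 l).le) hu
      refine le_trans (le_of_eq ?_) this
      congr 1
      refine Finset.sum_congr rfl fun k _ => ?_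
      rw [Finset.prod_mul_distrib, hW]
      push_cast
      ring) l₀
    refine le_trans ?_ h1
    rw [sum_insertNth l₀, Finset.mul_sum]
    refine Finset.sum_le_sum fun i _ => ?_
    have h2 := sum_mul_rpow_mul_le (by linarith : 1 ≤ s) (fun k' => μ (l₀.insertNth i k'))
      (fun k' => W (l₀.insertNth i k')) (fun _ => hμ0 _) (fun _ => hW0 _)
    have h3 : ∑ k', ‖(W (l₀.insertNth i k') : 𝕜) * a (l₀.insertNth i k')‖ ^ s
        = N * ∑ k', μ (l₀.insertNth i k') * W (l₀.insertNth i k') ^ s := by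
      rw [Finset.mul_sum]
      refine Finset.sum_congr rfl fun k' _ => ?_
      rw [norm_mul, RCLike.norm_ofReal, abs_of_nonneg (hW0 _),
        Real.mul_rpow (hW0 _) (norm_nonneg _), hμ]
      field_simp
    rw [h3, Real.mul_rpow hN0 (Finset.sum_nonneg fun _ _ =>
      mul_nonneg (hμ0 _) (Real.rpow_nonneg (hW0 _) _))]
    refine mul_le_mul_of_nonneg_left ?_ (by positivity)
    simpa only [Fin.insertNth_apply_same] using h2
  have hr : 0 < 1 - 1 / s := by
    rw [sub_pos, div_lt_one hs0]; linarith
  have hone : 1 ≤ ∑ l, θ l / (1 - 1 / s) * ∑ k, μ k * (M l (k l) ^ (1 / s - 1) * W k) := by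
    have hpt : ∀ k, μ k
        ≤ ∑ l, θ l / (1 - 1 / s) * (μ k * (M l (k l) ^ (1 / s - 1) * W k)) := by
      intro k
      -- AM-GM involves negative powers of the marginals; where μ_k > 0 they are positive, since μ_k
      -- ≤ M_l(k_l).
      rcases (hμ0 k).eq_or_lt with hk | hk
      · simp [← hk]
      · have h1 := one_le_sum_weighted hr θ (fun l => M l (k l)) hθ hsum
          (fun l => hk.trans_le (hμM l k))
        have h2 := mul_le_mul_of_nonneg_left h1 hk.le
        rw [mul_one, Finset.mul_sum, neg_sub] at h2
        refine h2.trans_eq (Finset.sum_congr rfl fun l _ => ?_)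
        ring
    calc (1 : ℝ) = ∑ k, μ k := hμ1.symm
      _ ≤ _ := Finset.sum_le_sum fun k _ => hpt k
      _ = _ := by
        rw [Finset.sum_comm]
        simp only [Finset.mul_sum]
  calc N ^ (1 / s) ≤ N ^ (1 / s) *
        ∑ l, θ l / (1 - 1 / s) * ∑ k, μ k * (M l (k l) ^ (1 / s - 1) * W k) :=
        le_mul_of_one_le_right (by positivity) hone
    _ = ∑ l, θ l / (1 - 1 / s)
        * (N ^ (1 / s) * ∑ k, μ k * (M l (k l) ^ (1 / s - 1) * W k)) := by
        rw [Finset.mul_sum]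
        exact Finset.sum_congr rfl fun l _ => by ring
    _ ≤ ∑ l, θ l / (1 - 1 / s) * C :=
        Finset.sum_le_sum fun l _ =>
          mul_le_mul_of_nonneg_left (hmixed l) (div_nonneg (hθ l) hr.le)
    _ = C := by
        rw [← Finset.sum_mul, ← Finset.sum_div, hsum, div_self hr.ne', one_mul]

/-! ### Forms on finite-dimensional ℓ_p spaces -/

theorem multilinear_apply_single_expansion {𝕜 : Type*} [RCLike 𝕜] {m n : ℕ} {p : Fin m → ℝ≥0∞}
    (T : MultilinearMap 𝕜 (fun j => FinEll 𝕜 (p j) n) 𝕜) (x : ∀ j, FinEll 𝕜 (p j) n) :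
    T x = ∑ k : Fin m → Fin n,
      (∏ j, x j (k j)) * T (fun j => PiLp.single (p j) (k j) (1 : 𝕜)) := by
  classical
  have hx : x = fun j => ∑ i : Fin n, (x j i) • PiLp.single (p j) i (1 : 𝕜) := by
    funext j
    ext i
    simp [Pi.single_apply]
  conv_lhs => rw [hx]
  rw [MultilinearMap.map_sum]
  exact Finset.sum_congr rfl fun k _ => MultilinearMap.map_smul_univ T (fun j => x j (k j)) _

theorem sum_rpow_mul_norm_rpow_le_one {𝕜 : Type*} [RCLike 𝕜] {n : ℕ} {p : ℝ} (hp : 0 < p)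
    (M : Fin n → ℝ) (u : Fin n → 𝕜) (hM : ∀ i, 0 ≤ M i) (hM1 : ∑ i, M i ≤ 1)
    (hu : ∀ i, ‖u i‖ ≤ 1) : ∑ i, ‖((M i ^ p⁻¹ : ℝ) : 𝕜) * u i‖ ^ p ≤ 1 := by
  refine le_trans (Finset.sum_le_sum fun i _ => ?_) hM1
  have h0 := Real.rpow_nonneg (hM i) p⁻¹
  calc ‖((M i ^ p⁻¹ : ℝ) : 𝕜) * u i‖ ^ p ≤ (M i ^ p⁻¹) ^ p := by
        refine Real.rpow_le_rpow (norm_nonneg _) ?_ hp.le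
        rw [norm_mul, RCLike.norm_ofReal, abs_of_nonneg h0]
        exact mul_le_of_le_one_right h0 (hu i)
    _ = M i := by
        rw [← Real.rpow_mul (hM i), inv_mul_cancel₀ hp.ne', Real.rpow_one]

theorem finEll_norm_le_one {𝕜 : Type*} [RCLike 𝕜] {n : ℕ} {p : ℝ≥0∞} (hp : 1 ≤ p)
    (M : Fin n → ℝ) (u : Fin n → 𝕜) (hM : ∀ i, 0 ≤ M i) (hM1 : ∑ i, M i ≤ 1)
    (hu : ∀ i, ‖u i‖ ≤ 1) :
    ‖(WithLp.toLp p fun i => ((M i ^ (p⁻¹).toReal : ℝ) : 𝕜) * u i : FinEll 𝕜 p n)‖ ≤ 1 := by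
  rcases eq_or_ne p ∞ with rfl | hne
  -- Here the exponent 1/p is 0, so the vector is u itself.
  · rw [PiLp.norm_toLp, pi_norm_le_iff_of_nonneg zero_le_one]
    intro i
    simpa using hu i
  · have hp0 : 0 < p.toReal := ENNReal.toReal_pos (by positivity) hne
    rw [PiLp.norm_eq_sum hp0, ENNReal.toReal_inv]
    exact Real.rpow_le_one (by positivity)
      (sum_rpow_mul_norm_rpow_le_one hp0 M u hM hM1 hu) (by positivity)

/-- Hardy–Littlewood inequality for multilinear forms on `ℓ_{p_1}^n × ⋯ × ℓ_{p_m}^n`. -/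
theorem hardyLittlewood_finEll {𝕜 : Type*} [RCLike 𝕜] {m n : ℕ} (hm : 1 ≤ m) (p : Fin m → ℝ≥0∞)
    [∀ j, Fact (1 ≤ p j)] (h1 : 1 / 2 ≤ ∑ j, ((p j)⁻¹).toReal) (h2 : ∑ j, ((p j)⁻¹).toReal < 1)
    (T : MultilinearMap 𝕜 (fun j => FinEll 𝕜 (p j) n) 𝕜) :
    (∑ k : Fin m → Fin n, ‖T (fun j => PiLp.single (p j) (k j) (1 : 𝕜))‖ ^
        (1 / (1 - ∑ j, ((p j)⁻¹).toReal))) ^ (1 - ∑ j, ((p j)⁻¹).toReal)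
      ≤ (2 : ℝ) ^ (((m : ℝ) - 1) * (1 - ∑ j, ((p j)⁻¹).toReal)) * finEllFormNorm T := by
  obtain ⟨d, rfl⟩ : ∃ d, m = d + 1 := ⟨m - 1, by omega⟩
  set σ := ∑ j, ((p j)⁻¹).toReal with hσ
  have hσ0 : 0 < 1 - σ := by linarith
  have hs : 2 ≤ 1 / (1 - σ) := by
    rw [le_div_iff₀ hσ0]; linarith
  have hmain := hardyLittlewood_array hs (fun j => ((p j)⁻¹).toReal)
    (fun _ => ENNReal.toReal_nonneg) (by rw [one_div_one_div]; ring)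
    (fun k => T (fun j => PiLp.single (p j) (k j) (1 : 𝕜))) (finEllFormNorm T) (by
      intro M u hM hM1 hu
      have hle := ContinuousMultilinearMap.le_opNorm
        (⟨T, finEll_multilinear_continuous T⟩ :
          ContinuousMultilinearMap 𝕜 (fun j => FinEll 𝕜 (p j) n) 𝕜)
        (fun j => WithLp.toLp (p j) fun i =>
          ((M j i ^ ((p j)⁻¹).toReal : ℝ) : 𝕜) * u j i)
      have hx := multilinear_apply_single_expansion T
        (fun j => WithLp.toLp (p j) fun i => ((M j i ^ ((p j)⁻¹).toReal : ℝ) : 𝕜) * u j i)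
      rw [← hx]
      refine hle.trans (mul_le_of_le_one_right (norm_nonneg _) ?_)
      exact Finset.prod_le_one (fun _ _ => norm_nonneg _) fun j _ =>
        finEll_norm_le_one Fact.out (M j) (u j) (hM j) (hM1 j) (hu j))
  rw [one_div_one_div] at hmain
  refine hmain.trans_eq ?_
  rw [← Real.rpow_natCast, ← Real.rpow_mul (by norm_num)]
  push_cast
  congr 2
  ring

/-! ### Forms on the sequence space ℓ_p -/

theorem ell_norm_sum_single_le_one {𝕜 : Type*} [RCLike 𝕜] {n : ℕ} {p : ℝ} (hp : 0 < p)
    (c : Fin n → 𝕜) (hc : ∑ i, ‖c i‖ ^ p ≤ 1) :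
    ‖∑ i : Fin n, c i • (lp.single (ENNReal.ofReal p) (i : ℕ) (1 : 𝕜) :
      Ell 𝕜 (ENNReal.ofReal p))‖ ≤ 1 := by
  set f : ℕ → 𝕜 := fun j => if h : j < n then c ⟨j, h⟩ else 0 with hf
  have hfc : ∀ i : Fin n, f i = c i := fun i => by simp [hf]
  have hpr : (ENNReal.ofReal p).toReal = p := ENNReal.toReal_ofReal hp.le
  have hsum : ∑ i : Fin n, c i • (lp.single (ENNReal.ofReal p) (i : ℕ) (1 : 𝕜) :
      Ell 𝕜 (ENNReal.ofReal p)) = ∑ i ∈ Finset.range n, lp.single (ENNReal.ofReal p) i (f i) := by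
    rw [← Fin.sum_univ_eq_sum_range (fun i => (lp.single (ENNReal.ofReal p) i (f i) :
      Ell 𝕜 (ENNReal.ofReal p)))]
    refine Finset.sum_congr rfl fun i _ => ?_
    rw [hfc, ← lp.single_smul, smul_eq_mul, mul_one]
  have hnorm := lp.norm_sum_single (E := fun _ : ℕ => 𝕜) (p := ENNReal.ofReal p)
    (by rwa [hpr]) f (Finset.range n)
  rw [hpr, ← Fin.sum_univ_eq_sum_range (fun i => ‖f i‖ ^ p)] at hnorm
  simp only [hfc] at hnorm
  rw [hsum]
  by_contra! hlt
  exact absurd (hnorm.trans_le hc) (not_le.2 (Real.one_lt_rpow hlt hp))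

/-- Finite sections of the Hardy–Littlewood inequality on the sequence space `ℓ_p`. -/
theorem hardyLittlewood_ell_section {𝕜 : Type*} [RCLike 𝕜] {m : ℕ} (hm : 1 ≤ m) {p : ℝ}
    [Fact (1 ≤ ENNReal.ofReal p)] (h1 : (m : ℝ) < p) (h2 : p ≤ 2 * m)
    (T : ContinuousMultilinearMap 𝕜 (fun _ : Fin m => Ell 𝕜 (ENNReal.ofReal p)) 𝕜) (n : ℕ) :
    (∑ k : Fin m → Fin n,
        ‖T (fun j => lp.single (ENNReal.ofReal p) (k j : ℕ) (1 : 𝕜))‖ ^ (p / (p - m)))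
          ^ ((p - m) / p)
      ≤ (2 : ℝ) ^ (((m : ℝ) - 1) * (p - m) / p) * ‖T‖ := by
  obtain ⟨d, rfl⟩ : ∃ d, m = d + 1 := ⟨m - 1, by omega⟩
  have hp0 : 0 < p := lt_of_le_of_lt (Nat.cast_nonneg _) h1
  -- This is the condition p ≤ 2m.
  have hs : 2 ≤ p / (p - (d + 1 : ℕ)) := by
    rw [le_div_iff₀ (by linarith)]; linarith
  have hmain := hardyLittlewood_array hs (fun _ => p⁻¹) (fun _ => by positivity) (by
      rw [one_div_div, Finset.sum_const, Finset.card_univ, Fintype.card_fin, nsmul_eq_mul]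
      field_simp
      ring)
    (fun k : Fin (d + 1) → Fin n =>
      T (fun j => lp.single (ENNReal.ofReal p) (k j : ℕ) (1 : 𝕜))) ‖T‖ (by
      intro M u hM hM1 hu
      have hle := T.le_opNorm (fun j => ∑ i : Fin n, (((M j i ^ p⁻¹ : ℝ) : 𝕜) * u j i) •
        (lp.single (ENNReal.ofReal p) (i : ℕ) (1 : 𝕜) : Ell 𝕜 (ENNReal.ofReal p)))
      have hx : T (fun j => ∑ i : Fin n, (((M j i ^ p⁻¹ : ℝ) : 𝕜) * u j i) •
          (lp.single (ENNReal.ofReal p) (i : ℕ) (1 : 𝕜) : Ell 𝕜 (ENNReal.ofReal p)))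
          = ∑ k : Fin (d + 1) → Fin n, (∏ j, (((M j (k j) ^ p⁻¹ : ℝ) : 𝕜) * u j (k j)))
            * T (fun j => lp.single (ENNReal.ofReal p) (k j : ℕ) (1 : 𝕜)) := by
        refine (T.toMultilinearMap.map_sum _).trans ?_
        exact Finset.sum_congr rfl fun k _ => T.toMultilinearMap.map_smul_univ
          (fun j => ((M j (k j) ^ p⁻¹ : ℝ) : 𝕜) * u j (k j)) _
      rw [← hx]
      refine hle.trans (mul_le_of_le_one_right (norm_nonneg _) ?_)
      exact Finset.prod_le_one (fun _ _ => norm_nonneg _) fun j _ =>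
        ell_norm_sum_single_le_one hp0 _
          (sum_rpow_mul_norm_rpow_le_one hp0 (M j) (u j) (hM j) (hM1 j) (hu j)))
  rw [one_div_div] at hmain
  refine hmain.trans_eq ?_
  rw [← Real.rpow_natCast, ← Real.rpow_mul (by norm_num)]
  push_cast
  congr 2
  ring

/-- Every finite set of multi-indices lies in some {0, …, n-1}^m, so bounds on the finite sections,
uniform in n, give summability. -/
theorem exists_sum_le_sum_fin {m : ℕ} (f : (Fin m → ℕ) → ℝ) (hf : ∀ k, 0 ≤ f k)
    (F : Finset (Fin m → ℕ)) :
    ∃ n : ℕ, ∑ k ∈ F, f k ≤ ∑ k : Fin m → Fin n, f (fun j => (k j : ℕ)) := by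
  classical
  refine ⟨F.sup (fun k => Finset.univ.sup k) + 1, ?_⟩
  set n := F.sup (fun k => Finset.univ.sup k) + 1 with hn
  have hinj : Function.Injective fun (k : Fin m → Fin n) (j : Fin m) => (k j : ℕ) :=
    fun k k' h => funext fun j => Fin.ext (congrFun h j)
  rw [← Finset.sum_image (s := Finset.univ) (f := f) hinj.injOn]
  refine Finset.sum_le_sum_of_subset_of_nonneg (fun k hk => ?_) fun k _ _ => hf k
  have hlt : ∀ j, k j < n := fun j => Nat.lt_succ_of_le
    ((Finset.le_sup (f := k) (Finset.mem_univ j)).trans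
      (Finset.le_sup (f := fun k : Fin m → ℕ => Finset.univ.sup k) hk))
  exact Finset.mem_image.2 ⟨fun j => ⟨k j, hlt j⟩, Finset.mem_univ _, rfl⟩

/-- Hardy–Littlewood inequality for continuous multilinear forms on the sequence space `ℓ_p`. -/
theorem hardyLittlewood_ell {𝕜 : Type*} [RCLike 𝕜] {m : ℕ} (hm : 1 ≤ m) {p : ℝ}
    [Fact (1 ≤ ENNReal.ofReal p)] (h1 : (m : ℝ) < p) (h2 : p ≤ 2 * m)
    (T : ContinuousMultilinearMap 𝕜 (fun _ : Fin m => Ell 𝕜 (ENNReal.ofReal p)) 𝕜) :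
    Summable (fun k : Fin m → ℕ =>
        ‖T (fun j => lp.single (ENNReal.ofReal p) (k j) (1 : 𝕜))‖ ^ (p / (p - m))) ∧
      (∑' k : Fin m → ℕ,
        ‖T (fun j => lp.single (ENNReal.ofReal p) (k j) (1 : 𝕜))‖ ^ (p / (p - m))) ^ ((p - m) / p)
        ≤ (2 : ℝ) ^ (((m : ℝ) - 1) * (p - m) / p) * ‖T‖ := by
  have hp0 : 0 < p := lt_of_le_of_lt (Nat.cast_nonneg _) h1
  have hpm : 0 < p - m := by linarith
  set f : (Fin m → ℕ) → ℝ := fun k =>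
    ‖T (fun j => lp.single (ENNReal.ofReal p) (k j) (1 : 𝕜))‖ ^ (p / (p - m)) with hf
  have hf0 : ∀ k, 0 ≤ f k := fun k => by positivity
  set B : ℝ := (2 : ℝ) ^ (((m : ℝ) - 1) * (p - m) / p) * ‖T‖ with hB
  have hB0 : 0 ≤ B := by positivity
  have hmul : (p - m) / p * (p / (p - m)) = 1 := by field_simp
  have hbound : ∀ F : Finset (Fin m → ℕ), ∑ k ∈ F, f k ≤ B ^ (p / (p - m)) := by
    intro F
    obtain ⟨n, hn⟩ := exists_sum_le_sum_fin f hf0 F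
    have hS0 : 0 ≤ ∑ k : Fin m → Fin n, f (fun j => (k j : ℕ)) :=
      Finset.sum_nonneg fun _ _ => hf0 _
    have h := Real.rpow_le_rpow (Real.rpow_nonneg hS0 _)
      (hardyLittlewood_ell_section hm h1 h2 T n) (by positivity : 0 ≤ p / (p - m))
    rw [← Real.rpow_mul hS0, hmul, Real.rpow_one] at h
    exact hn.trans h
  refine ⟨summable_of_sum_le hf0 hbound, ?_⟩
  have h := Real.rpow_le_rpow (tsum_nonneg hf0)
    (Real.tsum_le_of_sum_le hf0 hbound) (by positivity : 0 ≤ (p - m) / p)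
  rwa [← Real.rpow_mul hB0, mul_comm, hmul, Real.rpow_one] at h

/-! ### The optimal constant and the final statement -/

theorem hardyLittlewoodConstant_le {𝕜 : Type*} [RCLike 𝕜] {m : ℕ} (hm : 1 ≤ m) {p : ℝ}
    [Fact (1 ≤ ENNReal.ofReal p)] (h1 : (m : ℝ) < p) (h2 : p ≤ 2 * m) :
    hardyLittlewoodConstant 𝕜 m p
      ≤ ENNReal.ofReal ((2 : ℝ) ^ (((m : ℝ) - 1) * (p - m) / p)) := by
  have hp0 : 0 < p := lt_of_le_of_lt (Nat.cast_nonneg _) h1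
  have hpm : 0 < p - m := by linarith
  refine iInf₂_le (Real.toNNReal ((2 : ℝ) ^ (((m : ℝ) - 1) * (p - m) / p))) fun n _ T => ?_
  have hσ : ∑ _j : Fin m, ((ENNReal.ofReal p)⁻¹).toReal = m / p := by
    rw [Finset.sum_const, Finset.card_univ, Fintype.card_fin, nsmul_eq_mul, ENNReal.toReal_inv,
      ENNReal.toReal_ofReal hp0.le, div_eq_mul_inv]
  have hmain := hardyLittlewood_finEll hm (fun _ => ENNReal.ofReal p)
    (by rw [hσ, div_le_div_iff₀ (by norm_num) hp0]; linarith)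
    (by rw [hσ, div_lt_one hp0]; exact h1) T
  have h3 : 1 - (m : ℝ) / p = (p - m) / p := by field_simp
  rw [hσ, h3, one_div_div, ← mul_div_assoc] at hmain
  rwa [Real.coe_toNNReal _ (by positivity)]

/-- (p - m)/p = 1 - m/p increases with p and equals 1/(m + 1) at p = m + 1. -/
theorem two_rpow_exponent_le {m p : ℝ} (hm : 1 ≤ m) (h1 : m < p) (h2 : p ≤ m + 1) :
    (2 : ℝ) ^ ((m - 1) * (p - m) / p) ≤ 2 ^ ((m - 1) / (m + 1)) := by
  refine Real.rpow_le_rpow_of_exponent_le (by norm_num) ?_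
  rw [div_le_div_iff₀ (by linarith) (by linarith), mul_assoc]
  refine mul_le_mul_of_nonneg_left ?_ (by linarith)
  nlinarith

theorem two_rpow_div_lt_two {m : ℝ} (hm : 1 ≤ m) : (2 : ℝ) ^ ((m - 1) / (m + 1)) < 2 := by
  conv_rhs => rw [← Real.rpow_one 2]
  refine Real.rpow_lt_rpow_of_exponent_lt (by norm_num) ?_
  rw [div_lt_one (by linarith)]
  linarith

theorem theorem3p2 {𝕜 : Type*} [RCLike 𝕜] (m : ℕ) (hm : 2 ≤ m) :
    -- `m`-linear forms on `ℓ_{p_1}^n × ⋯ × ℓ_{p_m}^n`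
    (∀ p : Fin m → ℝ≥0∞, ∀ [∀ j, Fact (1 ≤ p j)], (∀ j, 1 < p j) →
      1 / 2 ≤ ∑ j, ((p j)⁻¹).toReal → ∑ j, ((p j)⁻¹).toReal < 1 →
      ∀ n : ℕ, 1 ≤ n → ∀ T : MultilinearMap 𝕜 (fun j => FinEll 𝕜 (p j) n) 𝕜,
        (∑ k : Fin m → Fin n, ‖T (fun j => PiLp.single (p j) (k j) (1 : 𝕜))‖ ^
            (1 / (1 - ∑ j, ((p j)⁻¹).toReal))) ^ (1 - ∑ j, ((p j)⁻¹).toReal)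
          ≤ (2 : ℝ) ^ (((m : ℝ) - 1) * (1 - ∑ j, ((p j)⁻¹).toReal)) * finEllFormNorm T) ∧
    -- continuous `m`-linear forms on `ℓ_p × ⋯ × ℓ_p` and the optimal constant, `m < p ≤ 2m`
    (∀ p : ℝ, ∀ [Fact (1 ≤ ENNReal.ofReal p)], (m : ℝ) < p → p ≤ 2 * m →
      (∀ T : ContinuousMultilinearMap 𝕜 (fun _ : Fin m => Ell 𝕜 (ENNReal.ofReal p)) 𝕜,
        Summable (fun k : Fin m → ℕ =>
          ‖T (fun j => lp.single (ENNReal.ofReal p) (k j) (1 : 𝕜))‖ ^ (p / (p - m))) ∧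
        (∑' k : Fin m → ℕ,
          ‖T (fun j => lp.single (ENNReal.ofReal p) (k j) (1 : 𝕜))‖ ^ (p / (p - m))) ^ ((p - m) / p)
          ≤ (2 : ℝ) ^ (((m : ℝ) - 1) * (p - m) / p) * ‖T‖) ∧
      hardyLittlewoodConstant 𝕜 m p ≤ ENNReal.ofReal ((2 : ℝ) ^ (((m : ℝ) - 1) * (p - m) / p))) ∧
    -- the uniform bound by `2` for `m < p ≤ m + 1`
    (∀ p : ℝ, ∀ [Fact (1 ≤ ENNReal.ofReal p)], (m : ℝ) < p → p ≤ m + 1 →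
      (∀ T : ContinuousMultilinearMap 𝕜 (fun _ : Fin m => Ell 𝕜 (ENNReal.ofReal p)) 𝕜,
        (∑' k : Fin m → ℕ,
          ‖T (fun j => lp.single (ENNReal.ofReal p) (k j) (1 : 𝕜))‖ ^ (p / (p - m))) ^ ((p - m) / p)
          ≤ (2 : ℝ) ^ (((m : ℝ) - 1) / (m + 1)) * ‖T‖) ∧
      (2 : ℝ) ^ (((m : ℝ) - 1) / (m + 1)) < 2 ∧
      hardyLittlewoodConstant 𝕜 m p < 2) := by
  have hm1 : 1 ≤ m := by omega
  have hmR : (1 : ℝ) ≤ m := by exact_mod_cast hm1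
  refine ⟨fun p _ _ h1 h2 n _ T => hardyLittlewood_finEll hm1 p h1 h2 T,
    fun p _ h1 h2 => ⟨fun T => hardyLittlewood_ell hm1 h1 h2 T,
      hardyLittlewoodConstant_le hm1 h1 h2⟩, fun p _ h1 h2 => ?_⟩
  have h2' : p ≤ 2 * m := by linarith
  have hexp := two_rpow_exponent_le hmR h1 h2
  refine ⟨fun T => (hardyLittlewood_ell hm1 h1 h2' T).2.trans
    (mul_le_mul_of_nonneg_right hexp (norm_nonneg _)), two_rpow_div_lt_two hmR, ?_⟩
  refine (hardyLittlewoodConstant_le hm1 h1 h2').trans_lt ?_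
  rw [← ENNReal.ofReal_ofNat 2]
  exact (ENNReal.ofReal_lt_ofReal_iff (by norm_num)).2 (hexp.trans_lt (two_rpow_div_lt_two hmR))
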